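/- Let $n,p\ge 0$ be integers, $f:\mathbb R^n\times\mathbb R^p\times\mathbb Z_{\ge0}\to\mathbb R^n$, and consider the stochastic system $X_{t+1}=f(X_t,u_t,t)+w_t$ and the associated deterministic system $x_{t+1}=f(x_t,u_t,t)$, $t\in\mathbb Z_{\ge 0}$, where the inputs $u_t\in\mathbb R^p$ are deterministic. Let $\|\cdot\|$ be the Euclidean norm and $\mathcal B^n(r,y)=\{x\in\mathbb R^n:\|x-y\|\le r\}$. Assume: 1. For every $t\ge 0$ there is $L_t\ge 0$ with $\|f(x,u,t)-f(y,u,t)\|\le L_t\|x-y\|$ for all $x,y\in\mathbb R^n$, $u\in\mathbb R^p$. 2. The disturbances $w_0,w_1,\dots$ are independent random vectors in $\mathbb R^n$ and each $w_t$ is sub-Gaussian with variance proxy $\sigma_t^2$, $\sigma_t\ge0$: $\mathbb E(w_t)=0$ and $\mathbb E\,e^{\lambda\langle \ell,w_t\rangle}\le e^{\lambda^2\sigma_t^2/2}$ for all $\lambda\in\mathbb R$ and all unit vectors $\ell\in\mathbb R^n$. 3. There are a set $\mathcal U\subseteq\mathbb R^p$, norms $\|\cdot\|_{\mathbb X}$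 on $\mathbb R^n$ and $\|\cdot\|_{\mathbb U}$ on $\mathbb R^p$, and constants $L_d,\rho\ge0$ such that for all $x\in\mathbb R^n$, $u\in\mathcal U$, $t\in\mathbb Z_{\ge0}$ the partial derivatives $D_xf(x,u,t)$ and $D_uf(x,u,t)$ exist and $\|D_xf(x,u,t)\|_{\mathbb X}\le L_d$, $\|D_uf(x,u,t)\|_{\mathbb X,\mathbb U}\le\rho$, where $\|A\|_{\mathbb X}=\sup_{\|v\|_{\mathbb X}\le1}\|Av\|_{\mathbb X}$ and $\|A\|_{\mathbb X,\mathbb U}=\sup_{\|v\|_{\mathbb U}\le1}\|Av\|_{\mathbb X}$ are the induced norms. Write $\mathcal B_{\mathbb X}(r,y)=\{x:\|x-y\|_{\mathbb X}\le r\}$, similarly $\mathcal B_{\mathbb U}$, and $A\oplus B=\{a+b:a\in A,\ b\in B\}$. Let $t\mapsto x_t^*$ be a trajectory of the deterministic system with input $t\mapsto u_t^*$, and let $t\mapsto X_t$ be the trajectory of the stochastic system starting from a (deterministic) $x_0\in\mathcal B_{\mathbb X}(r_1,x_0^*)$ with an input $t\mapsto u_t\in\mathcal B_{\mathbb U}(r_2,u_t^*)$,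 such that for every $t$ the line segment from $u_t^*$ to $u_t$ lies in $\mathcal U$ (for instance, because $\mathcal U$ is convex and contains $u_t$ and $u^*_t$, or because $\mathcal B_{\mathbb U}(r_2,u_t^*)\subseteq\mathcal U$). Then for all $t\in\mathbb Z_{\ge 0}$, $\delta\in(0,1]$ and $\varepsilon\in(0,1)$, with probability at least $1-\delta$, $$X_t\in\mathcal B_{\mathbb X}\Big(L_d^{\,t}r_1+\rho\,\tfrac{L_d^{\,t}-1}{L_d-1}\,r_2,\ x_t^*\Big)\oplus\mathcal B^n(r_{\delta,t},0),$$ where $\frac{L_d^t-1}{L_d-1}$ is read as $t$ if $L_d=1$, and $$r_{\delta,t}=\sqrt{\Psi_t\big(\varepsilon_1n+\varepsilon_2\log(1/\delta)\big)},\qquad \varepsilon_1=\frac{2\log(1+2/\varepsilon)}{(1-\varepsilon)^2},\qquad \varepsilon_2=\frac{2}{(1-\varepsilon)^2},\qquad \Psi_t=\sum_{k=0}^{t-1}\sigma_k^2\prod_{j=k+1}^{t-1}L_j^2 .$$ If all $L_k>0$ and $t\ge1$, then $\Psi_t=\psi_{t-1}\sum_{k=0}^{t-1}\sigma_k^2\psi_k^{-1}$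 with $\psi_t=\prod_{k=0}^tL_k^2$. -/

import Mathlib

open MeasureTheory ProbabilityTheory
open scoped Pointwise

namespace StochReach

noncomputable section

/-- The space `ℝⁿ` with its Euclidean norm. -/
abbrev Vec (n : ℕ) : Type := EuclideanSpace ℝ (Fin n)

/-- `x` is a trajectory of the deterministic system `x_{t+1} = f(x_t, u_t, t)` with input `u`. -/
def IsDetTrajectory {n p : ℕ} (f : Vec n → Vec p → ℕ → Vec n) (u : ℕ → Vec p)
    (x : ℕ → Vec n) : Prop :=
  ∀ t, x (t + 1) = f (x t) (u t) t

/-- `X` is a trajectory of the stochastic system `X_{t+1} = f(X_t, u_t, t) + w_t` with the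
(deterministic) input `u`, the disturbance `w` and the (deterministic) initial state `x₀`. -/
def IsStochTrajectory {n p : ℕ} {Ω : Type*} (f : Vec n → Vec p → ℕ → Vec n) (u : ℕ → Vec p)
    (w : ℕ → Ω → Vec n) (x₀ : Vec n) (X : ℕ → Ω → Vec n) : Prop :=
  (∀ ω, X 0 ω = x₀) ∧ ∀ t ω, X (t + 1) ω = f (X t ω) (u t) t + w t ω

/-- At every time `t`, the map `f(·, u, t)` is `L_t`-Lipschitz for the Euclidean norm, uniformly
in the input. -/
def LipschitzInState {n p : ℕ} (f : Vec n → Vec p → ℕ → Vec n) (L : ℕ → ℝ) : Prop :=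
  ∀ t, 0 ≤ L t ∧ ∀ (x y : Vec n) (u : Vec p), ‖f x u t - f y u t‖ ≤ L t * ‖x - y‖

/-- The random vector `W` is sub-Gaussian with variance proxy `σ²`: `E W = 0` and
`E exp(λ⟨ℓ, W⟩) ≤ exp(λ²σ²/2)` for all real `λ` and all unit vectors `ℓ`. -/
structure IsSubGaussianVec {n : ℕ} {Ω : Type*} [MeasurableSpace Ω] (P : Measure Ω)
    (W : Ω → Vec n) (σ : ℝ) : Prop where
  measurable : Measurable W
  integrable : Integrable W P
  mean_zero : ∫ ω, W ω ∂P = 0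
  integrable_exp : ∀ (lam : ℝ) (l : Vec n), ‖l‖ = 1 →
    Integrable (fun ω => Real.exp (lam * inner ℝ l (W ω))) P
  mgf_le : ∀ (lam : ℝ) (l : Vec n), ‖l‖ = 1 →
    ∫ ω, Real.exp (lam * inner ℝ l (W ω)) ∂P ≤ Real.exp (lam ^ 2 * σ ^ 2 / 2)

/-- A seminorm that is a norm. -/
def IsNorm {n : ℕ} (N : Seminorm ℝ (Vec n)) : Prop :=
  ∀ x, N x = 0 → x = 0

/-- The norm of a linear map `ℝᵐ → ℝⁿ` induced by the norm `NV` on `ℝᵐ` and the norm `NX` on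
`ℝⁿ`, that is `sup {NX (A v) : NV v ≤ 1}`. -/
def inducedNorm {m n : ℕ} (NX : Seminorm ℝ (Vec n)) (NV : Seminorm ℝ (Vec m))
    (A : Vec m →L[ℝ] Vec n) : ℝ :=
  sSup ((fun v => NX (A v)) '' {v | NV v ≤ 1})

/-- For all states `x`, inputs `u ∈ U` and times `t`, the partial derivatives `D_x f(x, u, t)` and
`D_u f(x, u, t)` exist and their induced norms are at most `Ld` and `ρ`. -/
structure BoundedDerivatives {n p : ℕ} (f : Vec n → Vec p → ℕ → Vec n) (U : Set (Vec p))
    (NX : Seminorm ℝ (Vec n)) (NU : Seminorm ℝ (Vec p)) (Ld ρ : ℝ) : Prop where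
  Ld_nonneg : 0 ≤ Ld
  rho_nonneg : 0 ≤ ρ
  differentiable_state : ∀ x, ∀ u ∈ U, ∀ t, DifferentiableAt ℝ (fun y => f y u t) x
  differentiable_input : ∀ x, ∀ u ∈ U, ∀ t, DifferentiableAt ℝ (fun v => f x v t) u
  state_le : ∀ x, ∀ u ∈ U, ∀ t, inducedNorm NX NX (fderiv ℝ (fun y => f y u t) x) ≤ Ld
  input_le : ∀ x, ∀ u ∈ U, ∀ t, inducedNorm NX NU (fderiv ℝ (fun v => f x v t) u) ≤ ρ

/-- `Ψ_t = ∑_{k<t} σ_k² ∏_{k<j<t} L_j²`. This makes sense also when some `L_j` vanish; see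
`Psi_eq_of_pos` for the quotient form. -/
def Psi (L σ : ℕ → ℝ) (t : ℕ) : ℝ :=
  ∑ k ∈ Finset.range t, σ k ^ 2 * ∏ j ∈ Finset.Ico (k + 1) t, L j ^ 2

/-- `ψ_t = ∏_{k=0}^t L_k²`. -/
def psi (L : ℕ → ℝ) (t : ℕ) : ℝ := ∏ k ∈ Finset.range (t + 1), L k ^ 2

/-- If all `L_k` are positive then `Ψ_t = ψ_{t-1} ∑_{k=0}^{t-1} σ_k² ψ_k⁻¹`. -/
theorem Psi_eq_of_pos (L σ : ℕ → ℝ) (hL : ∀ k, 0 < L k) (t : ℕ) :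
    Psi L σ (t + 1) = psi L t * ∑ k ∈ Finset.range (t + 1), σ k ^ 2 * (psi L k)⁻¹ := by
  unfold Psi
  rw [Finset.mul_sum]
  refine Finset.sum_congr rfl fun k hk => ?_
  have hk' : k + 1 ≤ t + 1 := Finset.mem_range.mp hk
  have h0 : psi L k ≠ 0 := Finset.prod_ne_zero_iff.mpr fun j _ => pow_ne_zero 2 (hL j).ne'
  have h1 : psi L k * ∏ j ∈ Finset.Ico (k + 1) (t + 1), L j ^ 2 = psi L t :=
    Finset.prod_range_mul_prod_Ico _ hk'
  rw [← h1]
  field_simp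

/-- `ε₁ = 2 log(1 + 2/ε) / (1 - ε)²`. -/
def eps1 (ε : ℝ) : ℝ := 2 * Real.log (1 + 2 / ε) / (1 - ε) ^ 2

/-- `ε₂ = 2 / (1 - ε)²`. -/
def eps2 (ε : ℝ) : ℝ := 2 / (1 - ε) ^ 2

/-- `r_{δ,t} = √(Ψ_t (ε₁ n + ε₂ log(1/δ)))`. -/
def devRadius (n : ℕ) (L σ : ℕ → ℝ) (ε δ : ℝ) (t : ℕ) : ℝ :=
  Real.sqrt (Psi L σ t * (eps1 ε * n + eps2 ε * Real.log (1 / δ)))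

/-- `(a^t - 1)/(a - 1) = 1 + a + ⋯ + a^{t-1}`, read as `t` for `a = 1`. -/
def geomFactor (a : ℝ) (t : ℕ) : ℝ :=
  if a = 1 then (t : ℝ) else (a ^ t - 1) / (a - 1)

end

end StochReach

namespace StochReach

/-! Let `x` be the deterministic trajectory from `x₀` with input `u`, and split `X t - xStar t` as
`(x t - xStar t) + (X t - x t)`. The first term is deterministic: the mean value inequality in state
and input gives the recursion `a ↦ Ld * a + ρ * r₂`.

The second term `D t` need not be centred, so its exponential moments are controlled only on average
over directions, through `Φ x = ∫ exp ⟨l, x⟩ dl` over the unit ball (`ballExp`). Rotation invariance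
and convexity make `Φ` a monotone function of `‖x‖`, so a Lipschitz step replaces `lam` by `lam * L
t` (`ballExp_le_of_norm_le`); independent sub-Gaussian noise costs a factor `exp (lam² σ² / 2)`
(`lintegral_ballExp_add_le`). Iterating yields `E Φ(lam D t) ≤ exp (lam² Ψ / 2) vol B`. Since `Φ x ≥
exp ((1 - ε)‖x‖) (ε / 2)ⁿ vol B` (`le_ballExp`), Markov's inequality with the optimal `lam` gives
the tail of `‖D t‖`. -/

/-! ### Induced norms and the mean value inequality -/

theorem continuous_seminorm {n : ℕ} (N : Seminorm ℝ (Vec n)) : Continuous N :=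
  N.convexOn.locallyLipschitz.continuous

/-- By compactness, `N` has a positive minimum on the Euclidean unit sphere; the sphere is empty
only in dimension zero. -/
theorem IsNorm.exists_norm_le {n : ℕ} {N : Seminorm ℝ (Vec n)} (hN : IsNorm N) :
    ∃ c : ℝ, ∀ x, ‖x‖ ≤ c * N x := by
  rcases (Metric.sphere (0 : Vec n) 1).eq_empty_or_nonempty with hS | hS
  · refine ⟨0, fun x => ?_⟩
    by_contra! hx
    have hx' : ‖x‖ ≠ 0 := by intro h; simp [h] at hx
    have : ‖x‖⁻¹ • x ∈ Metric.sphere (0 : Vec n) 1 := by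
      simp [norm_smul, hx']
    simp [hS] at this
  · obtain ⟨z, hz, hmin⟩ := (isCompact_sphere (0 : Vec n) 1).exists_isMinOn hS
      (continuous_seminorm N).continuousOn
    have hz1 : ‖z‖ = 1 := by simpa using hz
    have hpos : 0 < N z := lt_of_le_of_ne (apply_nonneg N z) fun h => by
      rw [hN z h.symm] at hz1; simp at hz1
    refine ⟨(N z)⁻¹, fun x => ?_⟩
    rcases eq_or_ne x 0 with rfl | hx
    · simp
    have hx' : 0 < ‖x‖ := norm_pos_iff.mpr hx
    have h1 : ‖x‖⁻¹ • x ∈ Metric.sphere (0 : Vec n) 1 := by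
      simp [norm_smul, hx'.ne']
    have h2 : N z ≤ ‖x‖⁻¹ * N x := by
      have : N z ≤ N (‖x‖⁻¹ • x) := hmin h1
      simpa [map_smul_eq_mul] using this
    rw [← div_eq_inv_mul, le_div_iff₀ hx'] at h2
    rw [← div_eq_inv_mul, le_div_iff₀ hpos]
    linarith

theorem bddAbove_inducedNorm {m n : ℕ} (NX : Seminorm ℝ (Vec n)) {NV : Seminorm ℝ (Vec m)}
    (hNV : IsNorm NV) (A : Vec m →L[ℝ] Vec n) :
    BddAbove ((fun v => NX (A v)) '' {v | NV v ≤ 1}) := by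
  obtain ⟨c, hc⟩ := hNV.exists_norm_le
  have hsub : {v | NV v ≤ 1} ⊆ Metric.closedBall (0 : Vec m) |c| := fun v hv => by
    have hv' : NV v ≤ 1 := hv
    have : c * NV v ≤ |c| * 1 :=
      mul_le_mul (le_abs_self c) hv' (apply_nonneg NV v) (abs_nonneg c)
    simpa using (hc v).trans this
  exact (((isCompact_closedBall (0 : Vec m) |c|).image
    ((continuous_seminorm NX).comp A.continuous)).bddAbove).mono (Set.image_mono hsub)

theorem le_inducedNorm_mul {m n : ℕ} (NX : Seminorm ℝ (Vec n)) {NV : Seminorm ℝ (Vec m)}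
    (hNV : IsNorm NV) (A : Vec m →L[ℝ] Vec n) (v : Vec m) :
    NX (A v) ≤ inducedNorm NX NV A * NV v := by
  rcases eq_or_ne v 0 with rfl | hv
  · simp
  have hpos : 0 < NV v := lt_of_le_of_ne (apply_nonneg NV v) fun h => hv (hNV v h.symm)
  have h1 : NV ((NV v)⁻¹ • v) ≤ 1 := by
    rw [map_smul_eq_mul, Real.norm_of_nonneg (by positivity), inv_mul_cancel₀ hpos.ne']
  have h2 : NX (A ((NV v)⁻¹ • v)) ≤ inducedNorm NX NV A :=
    le_csSup (bddAbove_inducedNorm NX hNV A) ⟨_, h1, rfl⟩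
  rw [map_smul, map_smul_eq_mul, Real.norm_of_nonneg (by positivity), ← div_eq_inv_mul,
    div_le_iff₀ hpos] at h2
  exact h2

/-- Hahn–Banach, extending `a • z ↦ a * N z` from the line through `z`. -/
theorem exists_dual_seminorm {n : ℕ} (N : Seminorm ℝ (Vec n)) (z : Vec n) :
    ∃ g : Vec n →L[ℝ] ℝ, g z = N z ∧ ∀ x, g x ≤ N x := by
  rcases eq_or_ne z 0 with rfl | hz
  · exact ⟨0, by simp, fun x => by simp⟩
  obtain ⟨g, hg, hle⟩ := exists_extension_of_le_sublinear
    (LinearPMap.mkSpanSingleton z (N z) hz) N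
    (fun c hc x => by simp [map_smul_eq_mul, abs_of_pos hc]) (fun x y => map_add_le_add N x y)
    (by
      rintro ⟨x, hx⟩
      obtain ⟨a, rfl⟩ := Submodule.mem_span_singleton.mp hx
      refine (LinearPMap.mkSpanSingleton'_apply z (N z) _ a hx).le.trans ?_
      simp only [RingHom.id_apply, smul_eq_mul, map_smul_eq_mul, Real.norm_eq_abs]
      exact mul_le_mul_of_nonneg_right (le_abs_self a) (apply_nonneg N z))
  refine ⟨LinearMap.toContinuousLinearMap g, ?_, hle⟩
  have := hg ⟨z, Submodule.mem_span_singleton_self z⟩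
  exact this.trans (LinearPMap.mkSpanSingleton_apply ℝ ℝ hz (N z))

/-- The mean value inequality for induced norms. -/
theorem seminorm_sub_le_of_inducedNorm_fderiv_le {m n : ℕ} (NX : Seminorm ℝ (Vec n))
    {NV : Seminorm ℝ (Vec m)} (hNV : IsNorm NV) {F : Vec m → Vec n} {a b : Vec m} {C : ℝ}
    (hF : ∀ v ∈ segment ℝ a b, DifferentiableAt ℝ F v)
    (hC : ∀ v ∈ segment ℝ a b, inducedNorm NX NV (fderiv ℝ F v) ≤ C) :
    NX (F b - F a) ≤ C * NV (b - a) := by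
  -- A functional norming the increment reduces the claim to the scalar mean value theorem.
  obtain ⟨g, hg, hle⟩ := exists_dual_seminorm NX (F b - F a)
  obtain ⟨c, hc, hder⟩ := domain_mvt (f := fun v => g (F v))
    (f' := fun v => g.comp (fderiv ℝ F v)) (s := segment ℝ a b)
    (fun v hv => (g.hasFDerivAt.comp v (hF v hv).hasFDerivAt).hasFDerivWithinAt)
    (convex_segment a b) (left_mem_segment ℝ a b) (right_mem_segment ℝ a b)
  have hc' : c ∈ segment ℝ a b := hc
  calc NX (F b - F a) = g (fderiv ℝ F c (b - a)) := by
        rw [← hg, map_sub]; simpa using hder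
    _ ≤ NX (fderiv ℝ F c (b - a)) := hle _
    _ ≤ inducedNorm NX NV (fderiv ℝ F c) * NV (b - a) := le_inducedNorm_mul NX hNV _ _
    _ ≤ C * NV (b - a) := mul_le_mul_of_nonneg_right (hC c hc') (apply_nonneg NV _)

/-! ### Recursions and the deterministic deviation -/

theorem geomFactor_zero (a : ℝ) : geomFactor a 0 = 0 := by
  simp [geomFactor]

theorem geomFactor_succ (a : ℝ) (t : ℕ) : geomFactor a (t + 1) = a * geomFactor a t + 1 := by
  unfold geomFactor
  split_ifs with h
  · simp [h]
  · have : a - 1 ≠ 0 := sub_ne_zero.mpr h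
    field_simp
    ring

theorem Psi_zero (L σ : ℕ → ℝ) : Psi L σ 0 = 0 := by
  simp [Psi]

theorem Psi_succ (L σ : ℕ → ℝ) (t : ℕ) :
    Psi L σ (t + 1) = L t ^ 2 * Psi L σ t + σ t ^ 2 := by
  unfold Psi
  rw [Finset.sum_range_succ, Finset.mul_sum]
  congr 1
  · refine Finset.sum_congr rfl fun k hk => ?_
    rw [Finset.prod_Ico_succ_top (Finset.mem_range.mp hk)]
    ring
  · simp

theorem Psi_nonneg (L σ : ℕ → ℝ) (t : ℕ) : 0 ≤ Psi L σ t :=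
  Finset.sum_nonneg fun _ _ => by positivity

/-- Two deterministic trajectories with nearby initial states and inputs stay close. -/
theorem seminorm_trajectory_sub_le {n p : ℕ} {f : Vec n → Vec p → ℕ → Vec n}
    {NX : Seminorm ℝ (Vec n)} (hNX : IsNorm NX) {NU : Seminorm ℝ (Vec p)} (hNU : IsNorm NU)
    {U : Set (Vec p)} {Ld ρ : ℝ} (hD : BoundedDerivatives f U NX NU Ld ρ)
    {uStar u : ℕ → Vec p} {xStar x : ℕ → Vec n} (hxStar : IsDetTrajectory f uStar xStar)
    (hx : IsDetTrajectory f u x) {r₁ r₂ : ℝ} (hx₀ : NX (x 0 - xStar 0) ≤ r₁)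
    (hu : ∀ t, NU (u t - uStar t) ≤ r₂) (hU : ∀ t, segment ℝ (uStar t) (u t) ⊆ U) (t : ℕ) :
    NX (x t - xStar t) ≤ Ld ^ t * r₁ + ρ * geomFactor Ld t * r₂ := by
  induction t with
  | zero => simpa [geomFactor_zero] using hx₀
  | succ t ih =>
    -- Change the state first, at input `uStar t ∈ U`, and then the input along the segment at the
    -- fixed state `x t`: derivative bounds are available only for inputs in `U`.
    have hs := hU t (left_mem_segment ℝ _ _)
    have h1 : NX (f (x t) (uStar t) t - f (xStar t) (uStar t) t) ≤ Ld * NX (x t - xStar t) :=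
      seminorm_sub_le_of_inducedNorm_fderiv_le NX hNX (F := fun y => f y (uStar t) t)
        (fun v _ => hD.differentiable_state v _ hs t) (fun v _ => hD.state_le v _ hs t)
    have h2 : NX (f (x t) (u t) t - f (x t) (uStar t) t) ≤ ρ * NU (u t - uStar t) :=
      seminorm_sub_le_of_inducedNorm_fderiv_le NX hNU (F := fun v => f (x t) v t)
        (fun v hv => hD.differentiable_input _ v (hU t hv) t)
        (fun v hv => hD.input_le _ v (hU t hv) t)
    calc NX (x (t + 1) - xStar (t + 1))
        = NX ((f (x t) (u t) t - f (x t) (uStar t) t)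
            + (f (x t) (uStar t) t - f (xStar t) (uStar t) t)) := by
          rw [hx t, hxStar t, sub_add_sub_cancel]
      _ ≤ ρ * NU (u t - uStar t) + Ld * NX (x t - xStar t) :=
          (map_add_le_add NX _ _).trans (add_le_add h2 h1)
      _ ≤ ρ * r₂ + Ld * (Ld ^ t * r₁ + ρ * geomFactor Ld t * r₂) :=
          add_le_add (mul_le_mul_of_nonneg_left (hu t) hD.rho_nonneg)
            (mul_le_mul_of_nonneg_left ih hD.Ld_nonneg)
      _ = Ld ^ (t + 1) * r₁ + ρ * geomFactor Ld (t + 1) * r₂ := by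
          rw [geomFactor_succ]; ring

/-! ### The exponential averaged over the unit ball -/

/-- The (unnormalized) average of `exp ⟨l, x⟩` over the unit ball. -/
noncomputable def ballExp {n : ℕ} (x : Vec n) : ENNReal :=
  ∫⁻ l in Metric.closedBall (0 : Vec n) 1, ENNReal.ofReal (Real.exp (inner ℝ l x))

theorem measurable_ballExp {n : ℕ} : Measurable (ballExp (n := n)) := by
  unfold ballExp
  refine Measurable.lintegral_prod_right' (f := fun z : Vec n × Vec n =>
    ENNReal.ofReal (Real.exp (inner ℝ z.2 z.1))) ?_
  fun_prop

theorem ballExp_zero {n : ℕ} : ballExp (0 : Vec n) = volume (Metric.closedBall (0 : Vec n) 1) := by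
  simp [ballExp]

/-- The substitution `l ↦ e l` preserves volume, the unit ball and inner products. -/
theorem ballExp_linearIsometryEquiv {n : ℕ} (e : Vec n ≃ₗᵢ[ℝ] Vec n) (x : Vec n) :
    ballExp (e x) = ballExp x := by
  have h := e.measurePreserving.setLIntegral_comp_preimage_emb
    e.toHomeomorph.measurableEmbedding
    (fun l => ENNReal.ofReal (Real.exp (inner ℝ l (e x)))) (Metric.closedBall (0 : Vec n) 1)
  rw [ballExp, ← h, ballExp, e.preimage_closedBall]
  simp

theorem ballExp_neg {n : ℕ} (x : Vec n) : ballExp (-x) = ballExp x :=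
  ballExp_linearIsometryEquiv (LinearIsometryEquiv.neg ℝ) x

/-- `c • x` is the convex combination of `x` and `-x` with weights `(1 ± c) / 2`; conclude by
convexity of `exp` and evenness of `ballExp`. -/
theorem ballExp_smul_le {n : ℕ} (x : Vec n) {c : ℝ} (hc₀ : 0 ≤ c) (hc₁ : c ≤ 1) :
    ballExp (c • x) ≤ ballExp x := by
  have hpt (l : Vec n) : ENNReal.ofReal (Real.exp (inner ℝ l (c • x))) ≤
      ENNReal.ofReal ((1 + c) / 2) * ENNReal.ofReal (Real.exp (inner ℝ l x)) +
      ENNReal.ofReal ((1 - c) / 2) * ENNReal.ofReal (Real.exp (inner ℝ l (-x))) := by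
    rw [← ENNReal.ofReal_mul (by linarith), ← ENNReal.ofReal_mul (by linarith),
      ← ENNReal.ofReal_add (mul_nonneg (by linarith) (Real.exp_pos _).le)
        (mul_nonneg (by linarith) (Real.exp_pos _).le)]
    refine ENNReal.ofReal_le_ofReal ?_
    have := (_root_.convexOn_exp).2 (Set.mem_univ (inner ℝ l x : ℝ)) (Set.mem_univ (inner ℝ l (-x) : ℝ))
      (by linarith : 0 ≤ (1 + c) / 2) (by linarith : 0 ≤ (1 - c) / 2) (by ring)
    refine le_trans (le_of_eq ?_) this
    congr 1
    simp only [inner_smul_right, inner_neg_right, smul_eq_mul]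
    ring
  have hm (y : Vec n) : Measurable fun l : Vec n => ENNReal.ofReal (Real.exp (inner ℝ l y)) :=
    by fun_prop
  calc ballExp (c • x)
      ≤ ENNReal.ofReal ((1 + c) / 2) * ballExp x + ENNReal.ofReal ((1 - c) / 2) * ballExp (-x) := by
        refine (lintegral_mono hpt).trans_eq ?_
        rw [lintegral_add_left ((hm x).const_mul _), lintegral_const_mul _ (hm x),
          lintegral_const_mul _ (hm (-x))]
        rfl
    _ = ballExp x := by
        rw [ballExp_neg, ← add_mul, ← ENNReal.ofReal_add (by linarith) (by linarith)]
        ring_nf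
        simp

theorem ballExp_le_of_norm_le {n : ℕ} {x y : Vec n} (h : ‖x‖ ≤ ‖y‖) : ballExp x ≤ ballExp y := by
  rcases eq_or_ne y 0 with rfl | hy
  · rw [norm_zero, norm_le_zero_iff] at h
    rw [h]
  have hy' : 0 < ‖y‖ := norm_pos_iff.mpr hy
  have hc : ‖(‖x‖ / ‖y‖) • y‖ = ‖x‖ := by
    rw [norm_smul, Real.norm_of_nonneg (by positivity), div_mul_cancel₀ _ hy'.ne']
  -- A reflection carries `x` to the multiple of `y` of the same norm.
  rw [← ballExp_linearIsometryEquiv (Submodule.reflection (ℝ ∙ (x - (‖x‖ / ‖y‖) • y))ᗮ) x,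
    Submodule.reflection_sub hc.symm]
  exact ballExp_smul_le y (by positivity) (div_le_one_of_le₀ h hy'.le)

/-- Integrate only over the ball of radius `ε / 2` about `(1 - ε / 2) x / ‖x‖`: it lies in the unit
ball, and there `⟨l, x⟩ ≥ (1 - ε)‖x‖`. -/
theorem le_ballExp {n : ℕ} (x : Vec n) {ε : ℝ} (hε₀ : 0 < ε) (hε₁ : ε < 1) :
    ENNReal.ofReal (Real.exp ((1 - ε) * ‖x‖) * (ε / 2) ^ n) *
      volume (Metric.closedBall (0 : Vec n) 1) ≤ ballExp x := by
  set e : Vec n := ‖x‖⁻¹ • x with he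
  have he1 : ‖e‖ ≤ 1 := by
    rw [he, norm_smul, norm_inv, norm_norm]; exact inv_mul_le_one
  have hex : inner ℝ e x = ‖x‖ := by
    rw [he, real_inner_smul_left, real_inner_self_eq_norm_sq]
    rcases eq_or_ne ‖x‖ 0 with h | h
    · simp [h]
    · field_simp
  set c : Vec n := (1 - ε / 2) • e with hc
  have hsub : Metric.closedBall c (ε / 2) ⊆ Metric.closedBall 0 1 := by
    refine Metric.closedBall_subset_closedBall' ?_
    rw [dist_zero_right, hc, norm_smul, Real.norm_of_nonneg (by linarith)]
    nlinarith [mul_le_mul_of_nonneg_left he1 (by linarith : (0:ℝ) ≤ 1 - ε / 2)]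
  have hlow : ∀ l ∈ Metric.closedBall c (ε / 2), ENNReal.ofReal (Real.exp ((1 - ε) * ‖x‖)) ≤
      ENNReal.ofReal (Real.exp (inner ℝ l x)) := fun l hl => by
    refine ENNReal.ofReal_le_ofReal (Real.exp_le_exp.mpr ?_)
    have h1 : |inner ℝ (l - c) x| ≤ ε / 2 * ‖x‖ :=
      (abs_real_inner_le_norm _ _).trans
        (mul_le_mul_of_nonneg_right (mem_closedBall_iff_norm.mp hl) (norm_nonneg x))
    have h2 : inner ℝ l x = inner ℝ (l - c) x + (1 - ε / 2) * ‖x‖ := by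
      rw [inner_sub_left, hc, real_inner_smul_left (r := 1 - ε / 2), hex]; ring
    rw [h2]
    linarith [(abs_le.mp h1).1]
  calc _ = ENNReal.ofReal (Real.exp ((1 - ε) * ‖x‖)) * volume (Metric.closedBall c (ε / 2)) := by
        rw [Measure.addHaar_closedBall' _ c (by linarith), finrank_euclideanSpace_fin,
          ENNReal.ofReal_mul (Real.exp_pos _).le, mul_assoc]
    _ ≤ ∫⁻ l in Metric.closedBall c (ε / 2), ENNReal.ofReal (Real.exp (inner ℝ l x)) := by
        rw [← setLIntegral_const]
        exact setLIntegral_mono' Metric.isClosed_closedBall.measurableSet hlow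
    _ ≤ ballExp x := lintegral_mono_set hsub

/-! ### Propagation of averaged moments along the stochastic system -/

theorem IsSubGaussianVec.lintegral_exp_le {n : ℕ} {Ω : Type*} [MeasurableSpace Ω]
    {P : Measure Ω} [IsProbabilityMeasure P] {W : Ω → Vec n} {σ : ℝ} (hW : IsSubGaussianVec P W σ)
    (lam : ℝ) {l : Vec n} (hl : ‖l‖ ≤ 1) :
    ∫⁻ ω, ENNReal.ofReal (Real.exp (inner ℝ l (lam • W ω))) ∂P ≤
      ENNReal.ofReal (Real.exp (lam ^ 2 * σ ^ 2 / 2)) := by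
  rcases eq_or_ne l 0 with rfl | hl0
  · simp only [inner_zero_left, Real.exp_zero, lintegral_const, measure_univ, mul_one]
    exact ENNReal.ofReal_le_ofReal (Real.one_le_exp (by positivity))
  have hl' : 0 < ‖l‖ := norm_pos_iff.mpr hl0
  have hunit : ‖‖l‖⁻¹ • l‖ = 1 := by
    rw [norm_smul, norm_inv, norm_norm, inv_mul_cancel₀ hl'.ne']
  have heq : (fun ω => Real.exp (inner ℝ l (lam • W ω))) =
      fun ω => Real.exp ((lam * ‖l‖) * inner ℝ (‖l‖⁻¹ • l) (W ω)) := by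
    funext ω
    rw [real_inner_smul_left, real_inner_smul_right]
    congr 1
    field_simp
  have hint := hW.integrable_exp (lam * ‖l‖) _ hunit
  have hle := hW.mgf_le (lam * ‖l‖) _ hunit
  rw [← heq] at hint hle
  rw [← ofReal_integral_eq_lintegral_ofReal hint (Filter.Eventually.of_forall fun _ =>
    (Real.exp_pos _).le)]
  refine ENNReal.ofReal_le_ofReal (hle.trans (Real.exp_le_exp.mpr ?_))
  have : ‖l‖ ^ 2 ≤ 1 := pow_le_one₀ hl'.le hl
  nlinarith [mul_nonneg (sq_nonneg lam) (sq_nonneg σ)]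

/-- Tonelli moves the expectation inside the ball integral; for each fixed `l`, independence factors
the exponential moment. -/
theorem lintegral_ballExp_add_le {n : ℕ} {Ω : Type*} [MeasurableSpace Ω] {P : Measure Ω}
    [IsProbabilityMeasure P] {V W : Ω → Vec n} {σ : ℝ} (hV : Measurable V)
    (hW : IsSubGaussianVec P W σ) (hVW : IndepFun V W P) (lam : ℝ) :
    ∫⁻ ω, ballExp (lam • (V ω + W ω)) ∂P ≤
      ENNReal.ofReal (Real.exp (lam ^ 2 * σ ^ 2 / 2)) * ∫⁻ ω, ballExp (lam • V ω) ∂P := by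
  have hWm := hW.measurable
  have hswap {Z : Ω → Vec n} (hZ : Measurable Z) : ∫⁻ ω, ballExp (lam • Z ω) ∂P =
      ∫⁻ l in Metric.closedBall (0 : Vec n) 1,
        ∫⁻ ω, ENNReal.ofReal (Real.exp (inner ℝ l (lam • Z ω))) ∂P := by
    refine lintegral_lintegral_swap (Measurable.aemeasurable ?_)
    simp only [Function.uncurry_def]
    fun_prop
  rw [hswap (Z := fun ω => V ω + W ω) (hV.add hWm), hswap hV, ← lintegral_const_mul _ (by
    refine Measurable.lintegral_prod_right' (f := fun z : Vec n × Ω =>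
      ENNReal.ofReal (Real.exp (inner ℝ z.1 (lam • V z.2)))) ?_
    fun_prop)]
  refine setLIntegral_mono' Metric.isClosed_closedBall.measurableSet fun l hl => ?_
  have hφ : Measurable fun y : Vec n => ENNReal.ofReal (Real.exp (inner ℝ l (lam • y))) := by
    fun_prop
  have hmul := lintegral_mul_eq_lintegral_mul_lintegral_of_indepFun'' (hφ.comp hV).aemeasurable
    (hφ.comp hWm).aemeasurable (hVW.comp hφ hφ)
  calc ∫⁻ ω, ENNReal.ofReal (Real.exp (inner ℝ l (lam • (V ω + W ω)))) ∂P
      = ∫⁻ ω, ENNReal.ofReal (Real.exp (inner ℝ l (lam • V ω))) *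
          ENNReal.ofReal (Real.exp (inner ℝ l (lam • W ω))) ∂P := by
        refine lintegral_congr fun ω => ?_
        rw [smul_add, inner_add_right, Real.exp_add, ENNReal.ofReal_mul (Real.exp_pos _).le]
    _ = (∫⁻ ω, ENNReal.ofReal (Real.exp (inner ℝ l (lam • V ω))) ∂P) *
          ∫⁻ ω, ENNReal.ofReal (Real.exp (inner ℝ l (lam • W ω))) ∂P := hmul
    _ ≤ _ := by
        rw [mul_comm]
        exact mul_le_mul_left (hW.lintegral_exp_le lam (mem_closedBall_zero_iff.mp hl)) _

theorem LipschitzInState.measurable {n p : ℕ} {f : Vec n → Vec p → ℕ → Vec n} {L : ℕ → ℝ}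
    (hL : LipschitzInState f L) (u : Vec p) (t : ℕ) : Measurable fun x => f x u t :=
  (LipschitzWith.of_dist_le_mul (K := ⟨L t, (hL t).1⟩) fun x y => by
    rw [dist_eq_norm, dist_eq_norm]; exact (hL t).2 x y u).continuous.measurable

/-- `X t` depends only on the disturbances before time `t`, which is what makes it independent of `w
t`. -/
theorem IsStochTrajectory.measurable_iSup {n p : ℕ} {Ω : Type*}
    {f : Vec n → Vec p → ℕ → Vec n} {L : ℕ → ℝ} (hL : LipschitzInState f L) {u : ℕ → Vec p}
    {w : ℕ → Ω → Vec n} {x₀ : Vec n} {X : ℕ → Ω → Vec n} (hX : IsStochTrajectory f u w x₀ X)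
    (t : ℕ) :
    Measurable[⨆ i ∈ Set.Iio t, MeasurableSpace.comap (w i) inferInstance] (X t) := by
  induction t with
  | zero =>
    rw [funext hX.1]
    exact measurable_const
  | succ t ih =>
    rw [funext (hX.2 t)]
    refine Measurable.add ?_ ?_
    · refine (hL.measurable (u t) t).comp (ih.mono ?_ le_rfl)
      exact biSup_mono fun i hi => (Set.mem_Iio.mp hi).trans t.lt_succ_self
    · exact (comap_measurable (w t)).mono
        (le_biSup (fun i => MeasurableSpace.comap (w i) inferInstance)
          (Set.mem_Iio.mpr t.lt_succ_self)) le_rfl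

theorem IsStochTrajectory.measurable {n p : ℕ} {Ω : Type*} [MeasurableSpace Ω]
    {f : Vec n → Vec p → ℕ → Vec n} {L : ℕ → ℝ} (hL : LipschitzInState f L) {u : ℕ → Vec p}
    {w : ℕ → Ω → Vec n} (hw : ∀ t, Measurable (w t)) {x₀ : Vec n} {X : ℕ → Ω → Vec n}
    (hX : IsStochTrajectory f u w x₀ X) (t : ℕ) : Measurable (X t) :=
  (hX.measurable_iSup hL t).mono (iSup₂_le fun i _ => (hw i).comap_le) le_rfl

theorem IsStochTrajectory.indepFun {n p : ℕ} {Ω : Type*} [MeasurableSpace Ω] {P : Measure Ω}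
    {f : Vec n → Vec p → ℕ → Vec n} {L : ℕ → ℝ} (hL : LipschitzInState f L) {u : ℕ → Vec p}
    {w : ℕ → Ω → Vec n} (hw : ∀ t, Measurable (w t)) (hindep : iIndepFun w P) {x₀ : Vec n}
    {X : ℕ → Ω → Vec n} (hX : IsStochTrajectory f u w x₀ X) (t : ℕ) :
    IndepFun (X t) (w t) P := by
  rw [IndepFun_iff_Indep]
  have h := indep_iSup_of_disjoint (fun i => (hw i).comap_le) hindep.iIndep
    (S := Set.Iio t) (T := {t}) (by simp)
  exact indep_of_indep_of_le_left (indep_of_indep_of_le_right h (by simp))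
    (hX.measurable_iSup hL t).comap_le

theorem lintegral_ballExp_trajectory_sub_le {n p : ℕ} {Ω : Type*} [MeasurableSpace Ω]
    {P : Measure Ω} [IsProbabilityMeasure P] {f : Vec n → Vec p → ℕ → Vec n} {L : ℕ → ℝ}
    (hL : LipschitzInState f L) {w : ℕ → Ω → Vec n} {σ : ℕ → ℝ}
    (hw : ∀ t, IsSubGaussianVec P (w t) (σ t)) (hindep : iIndepFun w P) {u : ℕ → Vec p}
    {x : ℕ → Vec n} (hx : IsDetTrajectory f u x) {X : ℕ → Ω → Vec n}
    (hX : IsStochTrajectory f u w (x 0) X) (t : ℕ) (lam : ℝ) :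
    ∫⁻ ω, ballExp (lam • (X t ω - x t)) ∂P ≤
      ENNReal.ofReal (Real.exp (lam ^ 2 * Psi L σ t / 2)) *
        volume (Metric.closedBall (0 : Vec n) 1) := by
  -- The induction hypothesis is needed at `lam * L t`.
  induction t generalizing lam with
  | zero => simp [hX.1, Psi_zero, ballExp_zero]
  | succ t ih =>
    have hφ : Measurable fun y => f y (u t) t - x (t + 1) :=
      (hL.measurable (u t) t).sub measurable_const
    have hXm := hX.measurable hL (fun i => (hw i).measurable) t
    have hind : IndepFun (fun ω => f (X t ω) (u t) t - x (t + 1)) (w t) P :=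
      (hX.indepFun hL (fun i => (hw i).measurable) hindep t).comp hφ measurable_id
    have hle (ω : Ω) : ballExp (lam • (f (X t ω) (u t) t - x (t + 1))) ≤
        ballExp ((lam * L t) • (X t ω - x t)) := by
      refine ballExp_le_of_norm_le ?_
      rw [norm_smul, norm_smul, norm_mul, Real.norm_of_nonneg (hL t).1, mul_assoc, hx t]
      exact mul_le_mul_of_nonneg_left ((hL t).2 _ _ _) (norm_nonneg _)
    calc ∫⁻ ω, ballExp (lam • (X (t + 1) ω - x (t + 1))) ∂P
        = ∫⁻ ω, ballExp (lam • ((f (X t ω) (u t) t - x (t + 1)) + w t ω)) ∂P := by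
          simp only [hX.2 t, add_sub_right_comm]
      _ ≤ ENNReal.ofReal (Real.exp (lam ^ 2 * σ t ^ 2 / 2)) *
            ∫⁻ ω, ballExp (lam • (f (X t ω) (u t) t - x (t + 1))) ∂P :=
          lintegral_ballExp_add_le (hφ.comp hXm) (hw t) hind lam
      _ ≤ ENNReal.ofReal (Real.exp (lam ^ 2 * σ t ^ 2 / 2)) *
            (ENNReal.ofReal (Real.exp ((lam * L t) ^ 2 * Psi L σ t / 2)) *
              volume (Metric.closedBall (0 : Vec n) 1)) := by
          gcongr
          exact (lintegral_mono hle).trans (ih (lam * L t))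
      _ = _ := by
          rw [← mul_assoc, ← ENNReal.ofReal_mul (Real.exp_pos _).le, ← Real.exp_add, Psi_succ]
          ring_nf

/-! ### Tail bounds for the norm -/

/-- A Chernoff bound for the norm of a random vector whose exponential moments are controlled on
average over the unit ball. -/
theorem measure_norm_ge_le {n : ℕ} {Ω : Type*} [MeasurableSpace Ω] {P : Measure Ω}
    {D : Ω → Vec n} {lam c r ε : ℝ} (hε₀ : 0 < ε) (hε₁ : ε < 1) (hlam : 0 ≤ lam)
    (hmgf : ∫⁻ ω, ballExp (lam • D ω) ∂P ≤
      ENNReal.ofReal (Real.exp c) * volume (Metric.closedBall (0 : Vec n) 1))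
    (hD : Measurable D) :
    P {ω | r ≤ ‖D ω‖} ≤ ENNReal.ofReal (Real.exp (c - (1 - ε) * (lam * r)) * (2 / ε) ^ n) := by
  set b := volume (Metric.closedBall (0 : Vec n) 1) with hb
  have hb0 : b ≠ 0 := (Metric.measure_closedBall_pos volume 0 one_pos).ne'
  have hbt : b ≠ ⊤ := measure_closedBall_lt_top.ne
  set a := Real.exp ((1 - ε) * (lam * r)) * (ε / 2) ^ n with ha
  have ha0 : 0 < a := by positivity
  have hsub : {ω | r ≤ ‖D ω‖} ⊆ {ω | ENNReal.ofReal a * b ≤ ballExp (lam • D ω)} := fun ω hω => by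
    refine le_trans ?_ (le_ballExp (lam • D ω) hε₀ hε₁)
    rw [norm_smul, Real.norm_of_nonneg hlam]
    have hε : 0 ≤ 1 - ε := by linarith
    have hω' : r ≤ ‖D ω‖ := hω
    rw [ha]
    gcongr
  have hmk : ENNReal.ofReal a * b * P {ω | r ≤ ‖D ω‖} ≤ ENNReal.ofReal (Real.exp c) * b :=
    calc _ ≤ ENNReal.ofReal a * b * P {ω | ENNReal.ofReal a * b ≤ ballExp (lam • D ω)} := by gcongr
      _ ≤ _ := (mul_meas_ge_le_lintegral
          (measurable_ballExp.comp (hD.const_smul lam)) _).trans hmgf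
  rw [mul_right_comm, ENNReal.mul_le_mul_iff_left hb0 hbt, mul_comm,
    ← ENNReal.le_div_iff_mul_le (by simp [ha0]) (by simp),
    ← ENNReal.ofReal_div_of_pos ha0] at hmk
  refine hmk.trans_eq (congrArg _ ?_)
  rw [ha, Real.exp_sub, div_pow, div_pow]
  field_simp

/-- If the exponential moments of `D`, averaged over the unit ball, are those of a sub-Gaussian
vector with variance proxy `ψ`, then the norm of `D` has a sub-Gaussian tail. -/
theorem measure_norm_gt_le {n : ℕ} {Ω : Type*} [MeasurableSpace Ω] {P : Measure Ω}
    {D : Ω → Vec n} {ψ ε δ : ℝ} (hψ : 0 ≤ ψ) (hε₀ : 0 < ε) (hε₁ : ε < 1) (hδ₀ : 0 < δ)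
    (hδ₁ : δ ≤ 1) (hD : Measurable D)
    (hmgf : ∀ lam : ℝ, ∫⁻ ω, ballExp (lam • D ω) ∂P ≤
      ENNReal.ofReal (Real.exp (lam ^ 2 * ψ / 2)) * volume (Metric.closedBall (0 : Vec n) 1)) :
    P {ω | Real.sqrt (ψ * (eps1 ε * n + eps2 ε * Real.log (1 / δ))) < ‖D ω‖} ≤
      ENNReal.ofReal δ := by
  have hε2 : 0 < 1 - ε := sub_pos.mpr hε₁
  rcases hψ.eq_or_lt with rfl | hψ
  -- For zero proxy the optimal `lam` is infinite: let `lam = m → ∞` at each threshold `1 / (k +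
  -- 1)`, then take the union over `k`.
  · have hnull : P {ω | 0 < ‖D ω‖} = 0 := by
      have hzero (k : ℕ) : P {ω | 1 / ((k : ℝ) + 1) ≤ ‖D ω‖} = 0 := by
        have hk : 0 < (1 - ε) * (1 / ((k : ℝ) + 1)) := by positivity
        have hlim : Filter.Tendsto (fun m : ℕ => ENNReal.ofReal
            (Real.exp (-((1 - ε) * (1 / ((k : ℝ) + 1)) * m)) * (2 / ε) ^ n))
            Filter.atTop (nhds 0) := by
          rw [← ENNReal.ofReal_zero, ← zero_mul ((2 / ε) ^ n)]
          refine ENNReal.tendsto_ofReal (Filter.Tendsto.mul_const _ ?_)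
          exact Real.tendsto_exp_neg_atTop_nhds_zero.comp
            (tendsto_natCast_atTop_atTop.const_mul_atTop hk)
        refine le_antisymm (ge_of_tendsto' hlim fun m => ?_) bot_le
        have := measure_norm_ge_le (r := 1 / ((k : ℝ) + 1)) hε₀ hε₁ m.cast_nonneg (hmgf m) hD
        refine this.trans_eq ?_
        congr 3
        ring
      refine measure_mono_null (fun ω hω => ?_) (measure_iUnion_null hzero)
      obtain ⟨k, hk⟩ := exists_nat_one_div_lt (show 0 < ‖D ω‖ from hω)
      exact Set.mem_iUnion.mpr ⟨k, hk.le⟩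
    simp only [zero_mul, Real.sqrt_zero, hnull, zero_le]
  · set q := eps1 ε * n + eps2 ε * Real.log (1 / δ) with hq
    have hlog1 : 0 ≤ Real.log (1 + 2 / ε) := Real.log_nonneg (by
      have : 0 < 2 / ε := by positivity
      linarith)
    have hlog2 : 0 ≤ Real.log (1 / δ) := Real.log_nonneg (by rw [le_div_iff₀ hδ₀]; linarith)
    have hq0 : 0 ≤ q := by
      rw [hq, eps1, eps2]; positivity
    set r := Real.sqrt (ψ * q) with hr
    have hr2 : r ^ 2 = ψ * q := Real.sq_sqrt (by positivity)
    have hr0 : 0 ≤ r := Real.sqrt_nonneg _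
    -- `lam = (1 - ε) r / ψ` minimizes the exponent `lam² ψ / 2 - (1 - ε) lam r`.
    refine (measure_mono fun ω (hω : r < ‖D ω‖) => (show r ≤ ‖D ω‖ from hω.le)).trans
      ((measure_norm_ge_le hε₀ hε₁ (by positivity) (hmgf ((1 - ε) * r / ψ)) hD).trans
        (ENNReal.ofReal_le_ofReal ?_))
    have hexp : ((1 - ε) * r / ψ) ^ 2 * ψ / 2 - (1 - ε) * ((1 - ε) * r / ψ * r) =
        Real.log δ - n * Real.log (1 + 2 / ε) := by
      have h1 : ((1 - ε) * r / ψ) ^ 2 * ψ / 2 - (1 - ε) * ((1 - ε) * r / ψ * r) =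
          -((1 - ε) ^ 2 * r ^ 2 / (2 * ψ)) := by
        field_simp; ring
      rw [h1, hr2, hq, eps1, eps2, one_div, Real.log_inv]
      field_simp
      ring
    rw [hexp, Real.exp_sub, Real.exp_log hδ₀, Real.exp_nat_mul, Real.exp_log (by positivity),
      div_mul_eq_mul_div, mul_div_assoc, ← div_pow]
    -- The term `ε₁ n` in the radius supplies `(1 + 2 / ε)⁻ⁿ`, which absorbs `(2 / ε)ⁿ`.
    refine mul_le_of_le_one_right hδ₀.le (pow_le_one₀ (by positivity) ?_)
    rw [div_le_one₀ (by positivity)]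
    linarith

/-- The trajectory of the deterministic system from `x₀` with input `u`. -/
def detTrajectory {n p : ℕ} (f : Vec n → Vec p → ℕ → Vec n) (u : ℕ → Vec p) (x₀ : Vec n) :
    ℕ → Vec n
  | 0 => x₀
  | t + 1 => f (detTrajectory f u x₀ t) (u t) t

end StochReach

theorem mainTheorem7 {n p : ℕ} {Ω : Type*} [MeasurableSpace Ω] (P : Measure Ω)
    [IsProbabilityMeasure P]
    (f : StochReach.Vec n → StochReach.Vec p → ℕ → StochReach.Vec n)
    (L : ℕ → ℝ) (hL : StochReach.LipschitzInState f L)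
    (w : ℕ → Ω → StochReach.Vec n) (σ : ℕ → ℝ) (hσ : ∀ t, 0 ≤ σ t)
    (hw : ∀ t, StochReach.IsSubGaussianVec P (w t) (σ t))
    (hindep : iIndepFun w P)
    (NX : Seminorm ℝ (StochReach.Vec n)) (hNX : StochReach.IsNorm NX)
    (NU : Seminorm ℝ (StochReach.Vec p)) (hNU : StochReach.IsNorm NU)
    (U : Set (StochReach.Vec p)) (Ld ρ : ℝ)
    (hD : StochReach.BoundedDerivatives f U NX NU Ld ρ)
    (uStar : ℕ → StochReach.Vec p) (xStar : ℕ → StochReach.Vec n)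
    (hxStar : StochReach.IsDetTrajectory f uStar xStar)
    (r₁ r₂ : ℝ)
    (x₀ : StochReach.Vec n) (hx₀ : x₀ ∈ NX.closedBall (xStar 0) r₁)
    (u : ℕ → StochReach.Vec p) (hu : ∀ t, u t ∈ NU.closedBall (uStar t) r₂)
    (hU : ∀ t, segment ℝ (uStar t) (u t) ⊆ U)
    (X : ℕ → Ω → StochReach.Vec n) (hX : StochReach.IsStochTrajectory f u w x₀ X)
    (ε : ℝ) (hε₀ : 0 < ε) (hε₁ : ε < 1) (δ : ℝ) (hδ₀ : 0 < δ) (hδ₁ : δ ≤ 1) (t : ℕ) :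
    1 - δ ≤ P.real {ω | X t ω ∈
      NX.closedBall (xStar t) (Ld ^ t * r₁ + ρ * StochReach.geomFactor Ld t * r₂) +
        Metric.closedBall (0 : StochReach.Vec n) (StochReach.devRadius n L σ ε δ t)} := by
  have hx : StochReach.IsDetTrajectory f u (StochReach.detTrajectory f u x₀) := fun _ => rfl
  have hdet := StochReach.seminorm_trajectory_sub_le hNX hNU hD hxStar hx
    ((Seminorm.mem_closedBall _).mp hx₀) (fun s => (Seminorm.mem_closedBall _).mp (hu s)) hU t
  have hXm := hX.measurable hL (fun i => (hw i).measurable) t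
  have hDm : Measurable fun ω => X t ω - StochReach.detTrajectory f u x₀ t :=
    hXm.sub measurable_const
  have htail := StochReach.measure_norm_gt_le (StochReach.Psi_nonneg L σ t) hε₀ hε₁ hδ₀ hδ₁ hDm
    (StochReach.lintegral_ballExp_trajectory_sub_le hL hw hindep hx hX t)
  set r := StochReach.devRadius n L σ ε δ t with hr
  have hmeas : MeasurableSet {ω | r < ‖X t ω - StochReach.detTrajectory f u x₀ t‖} :=
    measurableSet_lt measurable_const hDm.norm
  have hle : P.real {ω | r < ‖X t ω - StochReach.detTrajectory f u x₀ t‖} ≤ δ :=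
    ENNReal.toReal_le_of_le_ofReal hδ₀.le htail
  calc 1 - δ ≤ P.real {ω | r < ‖X t ω - StochReach.detTrajectory f u x₀ t‖}ᶜ := by
        rw [probReal_compl_eq_one_sub hmeas]; linarith
    -- Only an inclusion of events is used, so the target event need not be shown measurable.
    _ ≤ _ := measureReal_mono fun ω hω => by
        refine Set.mem_add.mpr ⟨StochReach.detTrajectory f u x₀ t,
          (Seminorm.mem_closedBall _).mpr hdet, X t ω - StochReach.detTrajectory f u x₀ t, ?_,
          add_sub_cancel _ _⟩
        simpa using hω
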